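/- A \emph{(planar knot) diagram with double lines} is a closed oriented curve in the plane whose only singularities are finitely many transverse double points, each of which is marked either as a classical crossing (with over/under information) or as a virtual crossing, together with finitely many marked points of the curve (\emph{double lines}), away from the double points, each carrying a sign $\pm1$. Such diagrams represent oriented knots in $S_g\times S^1$ ($S_g$ a closed oriented surface): a double line is a place where the knot crosses a fixed level surface $S_g\times\{x_0\}$, in the positive ($+1$) or negative ($-1$) direction of $S^1$, and over/under refers to the height in $S_g\times[0,1]$, the manifold $S_g\times S^1$ cut open along $S_g\times\{x_0\}$. A \emph{virtual knot diagram} is such a diagram without double lines. The \emph{generalized Reidemeister moves} are: planar isotopy (and orientation preserving reparametrization of the curve); the first and the second Reidemeister moves, with classical or with virtual crossings; and the third Reidemeister move with three classical crossings, with three virtual crossings, or with one classical and two virtual crossings. They are performed in a disc that contains no double lines. The \emph{moves for knots in $S_g\times S^1$} are the generalized Reidemeister moves (on diagrams with double lines) together with: (a) a double line slides along its strand through a crossing with another strand, where a virtual crossing stays virtual and a classical crossing is changed, the sliding strand being under just after a double line of sign $+1$ and just before one of sign $-1$, and over just before a double line of sign $+1$ and just after one of sign $-1$ ("before" and "after"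 along the orientation); (b) two neighbouring double lines of opposite signs on an arc without crossings appear or disappear. **Theorem.** Let $D_1$ and $D_2$ be virtual knot diagrams. Then $D_1$ and $D_2$ are related by a finite sequence of moves for knots in $S_g\times S^1$ (through arbitrary diagrams with double lines) if and only if they are related by a finite sequence of generalized Reidemeister moves (through virtual knot diagrams). The same holds for unoriented knots, that is, if reversing the orientation of the whole diagram (which changes the sign of every double line) is admitted as a further move on both sides. In other words, virtual knot theory embeds in the theory of knots in $S_g\times S^1$. -/

import Mathlib

open Set Topology

namespace SgS1

/-- Two distinct parameters of a closed plane curve that are mapped to the same point. -/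
def Meet (γ : C(UnitAddCircle, ℝ × ℝ)) (s t : UnitAddCircle) : Prop :=
  s ≠ t ∧ γ s = γ t

/-- An oriented knot diagram with virtual crossings and double lines on the plane: a closed curve,
oriented by its parameter, whose only singularities are finitely many transverse double points.
A double point is a classical crossing if one of its branches is declared to pass over the other
one, and a virtual crossing otherwise. -/
structure DLDiagram where
  /-- the underlying plane curve -/
  curve : C(UnitAddCircle, ℝ × ℝ)
  finite_meet : {p : UnitAddCircle × UnitAddCircle | Meet curve p.1 p.2}.Finite
  no_triple : ∀ s t u, Meet curve s t → Meet curve s u → t = u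
  /-- in suitable coordinates, the two branches are the two coordinate axes near a double point -/
  transverse : ∀ s t, Meet curve s t → ∃ e : (ℝ × ℝ) ≃ₜ (ℝ × ℝ),
    (∀ᶠ u in 𝓝 s, (e (curve u)).2 = 0) ∧ (∀ᶠ u in 𝓝 t, (e (curve u)).1 = 0)
  /-- `Over s t`: there is a classical crossing at which the branch of `s` is over that of `t` -/
  Over : UnitAddCircle → UnitAddCircle → Prop
  over_meet : ∀ s t, Over s t → Meet curve s t
  over_asymm : ∀ s t, Over s t → ¬ Over t s
  /-- the sign of the double line at a parameter, `0` if there is none; the sign is `1` if the knot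
  crosses the level surface `S_g × {x₀}` in the positive direction of `S¹`, so that it leaves
  `S_g × [0,1]` at the top and comes back at the bottom, and it is `-1` in the opposite case -/
  line : UnitAddCircle → SignType
  finite_line : {t | line t ≠ 0}.Finite
  line_of_meet : ∀ s t, Meet curve s t → line s = 0

/-- A virtual knot diagram: a diagram without double lines. -/
def VirtualDiagram : Type := {D : DLDiagram // ∀ t, D.line t = 0}

/-- The arc of the parameter circle with midpoint `s` and half-length `|δ|`, parametrized
by `u ∈ [-1, 1]`; it is positively oriented if `0 < δ`, negatively if `δ < 0`. -/
def arc (s δ u : ℝ) : UnitAddCircle := ((s + δ * u : ℝ) : UnitAddCircle)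

/-- Ambient isotopy of the plane. -/
def PlanarIsotopy (D D' : DLDiagram) : Prop :=
  ∃ H : unitInterval → ((ℝ × ℝ) ≃ₜ (ℝ × ℝ)),
    (Continuous fun p : unitInterval × (ℝ × ℝ) => H p.1 p.2) ∧
    (∀ x, H 0 x = x) ∧
    (∀ t, D'.curve t = H 1 (D.curve t)) ∧
    (∀ s t, D'.Over s t ↔ D.Over s t) ∧
    (∀ t, D'.line t = D.line t)

/-- Orientation preserving change of the parameter. -/
def Reparametrization (D D' : DLDiagram) : Prop :=
  ∃ φ : UnitAddCircle ≃ₜ UnitAddCircle,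
    (∃ f : CircleDeg1Lift, ∀ x : ℝ, φ (x : UnitAddCircle) = ((f x : ℝ) : UnitAddCircle)) ∧
    (∀ t, D'.curve t = D.curve (φ t)) ∧
    (∀ s t, D'.Over s t ↔ D.Over (φ s) (φ t)) ∧
    (∀ t, D'.line t = D.line (φ t))

/-- `D'` arises from `D` by replacing, inside a disc, the picture `P` by the picture `P'`. The disc
is the image of the square `[-1,1]²` under a homeomorphism of the plane; it meets the diagrams
exactly in the arcs `arc (s i) (δ i)`, which may be traversed in any direction and carry no double
lines. Nothing changes outside. -/
structure Replacement {n : ℕ} (P P' : Fin n → ℝ → ℝ × ℝ) (s δ : Fin n → ℝ)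
    (D D' : DLDiagram) : Prop where
  arcs_disjoint : ∀ i j, ∀ u ∈ Icc (-1 : ℝ) 1, ∀ v ∈ Icc (-1 : ℝ) 1,
    arc (s i) (δ i) u = arc (s j) (δ j) v → i = j ∧ u = v
  picture : ∃ e : (ℝ × ℝ) ≃ₜ (ℝ × ℝ),
    (∀ i, ∀ u ∈ Icc (-1 : ℝ) 1,
      D.curve (arc (s i) (δ i) u) = e (P i u) ∧ D'.curve (arc (s i) (δ i) u) = e (P' i u)) ∧
    (∀ t, (∀ i, ∀ u ∈ Icc (-1 : ℝ) 1, t ≠ arc (s i) (δ i) u) →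
      D'.curve t = D.curve t ∧
        D.curve t ∉ e '' (Icc (-1 : ℝ) 1 ×ˢ Icc (-1 : ℝ) 1))
  over_outside : ∀ p q, (∀ i, ∀ u ∈ Icc (-1 : ℝ) 1, p ≠ arc (s i) (δ i) u) →
    (∀ i, ∀ u ∈ Icc (-1 : ℝ) 1, q ≠ arc (s i) (δ i) u) → (D'.Over p q ↔ D.Over p q)
  line_eq : ∀ t, D'.line t = D.line t
  line_arc : ∀ i, ∀ u ∈ Icc (-1 : ℝ) 1, D.line (arc (s i) (δ i) u) = 0

/-- A horizontal segment. -/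
noncomputable def R1before : Fin 1 → ℝ → ℝ × ℝ := fun _ u => (u, 1 / 2)

/-- A kink, with its double point at the parameters `±1/2`. -/
noncomputable def R1after : Fin 1 → ℝ → ℝ × ℝ :=
  fun _ u => (u * (4 * u ^ 2 - 1) / 3, u ^ 2 - 1 / 2)

/-- Two parallel segments. -/
noncomputable def R2before : Fin 2 → ℝ → ℝ × ℝ :=
  ![fun u => (u, 1 / 2), fun u => (u, -1 / 2)]

/-- Two parabolic arcs bounding a bigon, with corners at the parameters `±1/2` of both. -/
noncomputable def R2after : Fin 2 → ℝ → ℝ × ℝ :=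
  ![fun u => (u, (4 * u ^ 2 - 1) / 6), fun u => (u, (1 - 4 * u ^ 2) / 6)]

/-- The two diagonals and an arc above their intersection point. -/
noncomputable def R3before : Fin 3 → ℝ → ℝ × ℝ :=
  ![fun u => (u, u), fun u => (u, -u), fun u => (u, 2 * (1 - u ^ 2) / 3)]

/-- The two diagonals and an arc below their intersection point. -/
noncomputable def R3after : Fin 3 → ℝ → ℝ × ℝ :=
  ![fun u => (u, u), fun u => (u, -u), fun u => (u, -(2 * (1 - u ^ 2) / 3))]

/-- Strands `i ≠ j` of `R3before` meet at the parameter `R3param i j` of both strands,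
those of `R3after` at the parameter `-R3param i j` of both strands. -/
noncomputable def R3param : Fin 3 → Fin 3 → ℝ :=
  ![![0, 0, 1 / 2], ![0, 0, -1 / 2], ![1 / 2, -1 / 2, 0]]

/-- The crossing types allowed in a third move, where `ov i j` says that strand `i` passes over
strand `j`: three classical crossings with a top, a middle and a bottom strand; three virtual
crossings; one classical crossing and two virtual ones. -/
def R3Allowed (ov : Fin 3 → Fin 3 → Prop) : Prop :=
  (∃ height : Equiv.Perm (Fin 3), ∀ i j, ov i j ↔ height j < height i) ∨
  (∀ i j, ¬ ov i j) ∨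
  (∃ a b, ∀ i j, ov i j ↔ i = a ∧ j = b)

/-- First Reidemeister move, classical or virtual. -/
def Reidemeister1 (D D' : DLDiagram) : Prop :=
  ∃ s δ : Fin 1 → ℝ, Replacement R1before R1after s δ D D'

/-- Second Reidemeister move: both new crossings are virtual, or the same strand is over at
both. -/
def Reidemeister2 (D D' : DLDiagram) : Prop :=
  ∃ s δ : Fin 2 → ℝ, Replacement R2before R2after s δ D D' ∧
    ∀ i j, D'.Over (arc (s i) (δ i) (1 / 2)) (arc (s j) (δ j) (1 / 2)) ↔
      D'.Over (arc (s i) (δ i) (-1 / 2)) (arc (s j) (δ j) (-1 / 2))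

/-- Third Reidemeister move: classical, virtual or semivirtual. -/
def Reidemeister3 (D D' : DLDiagram) : Prop :=
  ∃ s δ : Fin 3 → ℝ, Replacement R3before R3after s δ D D' ∧
    ∃ ov : Fin 3 → Fin 3 → Prop, R3Allowed ov ∧ ∀ i j,
      (D.Over (arc (s i) (δ i) (R3param i j)) (arc (s j) (δ j) (R3param i j)) ↔ ov i j) ∧
      (D'.Over (arc (s i) (δ i) (-R3param i j)) (arc (s j) (δ j) (-R3param i j)) ↔ ov i j)

/-- The generalized Reidemeister moves (and the trivial changes of a diagram). -/
inductive ReidemeisterStep : DLDiagram → DLDiagram → Prop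
  | isotopy {D D'} : PlanarIsotopy D D' → ReidemeisterStep D D'
  | reparam {D D'} : Reparametrization D D' → ReidemeisterStep D D'
  | r1 {D D'} : Reidemeister1 D D' → ReidemeisterStep D D'
  | r2 {D D'} : Reidemeister2 D D' → ReidemeisterStep D D'
  | r3 {D D'} : Reidemeister3 D D' → ReidemeisterStep D D'

/-- A double line of sign `ε` slides along its strand, from before to behind the crossing of that
strand (at the parameter `s`) with another one (at the parameter `t`). A virtual crossing stays
virtual. A classical crossing is changed: just behind a double line of sign `1`, and just before
one of sign `-1`, the sliding strand is at the bottom of `S_g × [0,1]` and hence under; just before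
a double line of sign `1`, and just behind one of sign `-1`, it is over. -/
def LineSlide (D D' : DLDiagram) : Prop :=
  ∃ (s δ : ℝ) (t : UnitAddCircle) (ε : SignType), 0 < δ ∧ 2 * δ < 1 ∧ ε ≠ 0 ∧
    D'.curve = D.curve ∧
    Meet D.curve (arc s δ 0) t ∧
    (∀ u ∈ Icc (-1 : ℝ) 1, u ≠ 0 → ∀ p, ¬ Meet D.curve (arc s δ u) p) ∧
    D.line (arc s δ (-1 / 2)) = ε ∧
    (∀ u ∈ Icc (-1 : ℝ) 1, u ≠ -1 / 2 → D.line (arc s δ u) = 0) ∧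
    D'.line (arc s δ (1 / 2)) = ε ∧
    (∀ u ∈ Icc (-1 : ℝ) 1, u ≠ 1 / 2 → D'.line (arc s δ u) = 0) ∧
    (∀ p, (∀ u ∈ Icc (-1 : ℝ) 1, p ≠ arc s δ u) → D'.line p = D.line p) ∧
    (∀ p q, p ≠ arc s δ 0 → q ≠ arc s δ 0 → (D'.Over p q ↔ D.Over p q)) ∧
    ((ε = 1 ∧ D.Over t (arc s δ 0) ∧ D'.Over (arc s δ 0) t) ∨
      (ε = -1 ∧ D.Over (arc s δ 0) t ∧ D'.Over t (arc s δ 0)) ∨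
      (¬ D.Over (arc s δ 0) t ∧ ¬ D.Over t (arc s δ 0) ∧
        ¬ D'.Over (arc s δ 0) t ∧ ¬ D'.Over t (arc s δ 0)))

/-- Two neighbouring double lines of opposite signs appear. -/
def LinePair (D D' : DLDiagram) : Prop :=
  ∃ (s δ : ℝ) (ε : SignType), 0 < δ ∧ 2 * δ < 1 ∧ ε ≠ 0 ∧
    D'.curve = D.curve ∧
    (∀ p q, D'.Over p q ↔ D.Over p q) ∧
    (∀ u ∈ Icc (-1 : ℝ) 1, ∀ p, ¬ Meet D.curve (arc s δ u) p) ∧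
    (∀ u ∈ Icc (-1 : ℝ) 1, D.line (arc s δ u) = 0) ∧
    D'.line (arc s δ (-1 / 2)) = ε ∧
    D'.line (arc s δ (1 / 2)) = -ε ∧
    (∀ p, p ≠ arc s δ (-1 / 2) → p ≠ arc s δ (1 / 2) → D'.line p = D.line p)

/-- The moves for knots in `S_g × S¹`. -/
inductive DLStep : DLDiagram → DLDiagram → Prop
  | reidemeister {D D'} : ReidemeisterStep D D' → DLStep D D'
  | slide {D D'} : LineSlide D D' → DLStep D D'
  | pair {D D'} : LinePair D D' → DLStep D D'

/-- `D'` is `D` with the opposite orientation. -/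
def Reversal (D D' : DLDiagram) : Prop :=
  (∀ t, D'.curve t = D.curve (-t)) ∧
  (∀ s t, D'.Over s t ↔ D.Over (-s) (-t)) ∧
  (∀ t, D'.line t = -D.line (-t))

/-- Equivalence of oriented diagrams as knots in `S_g × S¹`. -/
def DLEquiv : DLDiagram → DLDiagram → Prop := Relation.EqvGen DLStep

/-- Equivalence of virtual knot diagrams, as oriented virtual knots. -/
def VirtualEquiv : VirtualDiagram → VirtualDiagram → Prop :=
  Relation.EqvGen fun D D' => ReidemeisterStep D.1 D'.1

/-- Equivalence as knots in `S_g × S¹`, orientations being ignored. -/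
def UnorientedDLEquiv : DLDiagram → DLDiagram → Prop :=
  Relation.EqvGen fun D D' => DLStep D D' ∨ Reversal D D'

/-- Equivalence as virtual knots, orientations being ignored. -/
def UnorientedVirtualEquiv : VirtualDiagram → VirtualDiagram → Prop :=
  Relation.EqvGen fun D D' => ReidemeisterStep D.1 D'.1 ∨ Reversal D.1 D'.1

end SgS1

/-!
A diagram with double lines whose signs add up to zero describes a knot that lifts to the infinite
cyclic covering `S_g × ℝ` of `S_g × S¹`, and a diagram of the lift is a virtual knot diagram. Here
the lift is encoded by a *level function* `L` on the parameter circle (`IsLevel`): it is locally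
constant away from the double lines and jumps by the sign at each of them, so that `L t` numbers the
sheet of the covering that contains the lifted knot at the parameter `t`. The virtual diagram
`D.unwind L` of the lift has the same curve and the same virtual crossings as `D`. At a classical
crossing the strand on the higher level is over; if both strands are on the same level, the
crossing of `D` is kept.

Moving or creating double lines does not change the lift: with a suitable new level function, the
unwound diagram is literally the same (`LineSlide.unwind_eq`, `LinePair.unwind_eq`). A Reidemeister
move takes place in a disc without double lines, where each strand has a constant level, and
therefore lifts to a Reidemeister move of the same kind; in a third move the strands are ordered
lexicographically by level and then by height. So equivalent diagrams have equivalent unwound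
diagrams, and those with a level function are only related to those with a level function. Finally,
a level function of a virtual diagram is constant on the circle, so that a virtual diagram is its
own unwound diagram (`unwind_virtual`). This gives the nontrivial implications.
-/

namespace SgS1

/-! ### Functions on the circle with prescribed jumps -/

/-- The function `L` on the circle is locally constant from the right, and at each point `x` it
exceeds its limit from the left by `j x`. -/
def IsLevel (L j : UnitAddCircle → ℤ) : Prop :=
  ∀ x : ℝ, (∀ᶠ y : ℝ in 𝓝[>] x, L (y : UnitAddCircle) = L (x : UnitAddCircle)) ∧
    ∀ᶠ y : ℝ in 𝓝[<] x, L (y : UnitAddCircle) = L (x : UnitAddCircle) - j (x : UnitAddCircle)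

namespace IsLevel

variable {L M j k : UnitAddCircle → ℤ}

lemma add (hL : IsLevel L j) (hM : IsLevel M k) :
    IsLevel (fun t => L t + M t) (fun t => j t + k t) := fun x => by
  constructor
  · filter_upwards [(hL x).1, (hM x).1] with y h₁ h₂
    rw [h₁, h₂]
  · filter_upwards [(hL x).2, (hM x).2] with y h₁ h₂
    rw [h₁, h₂]; ring

lemma const_mul (hL : IsLevel L j) (c : ℤ) :
    IsLevel (fun t => c * L t) (fun t => c * j t) := fun x => by
  constructor
  · filter_upwards [(hL x).1] with y h
    rw [h]
  · filter_upwards [(hL x).2] with y h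
    rw [h]; ring

lemma eventually_eq (hL : IsLevel L j) {x : ℝ} (hx : j (x : UnitAddCircle) = 0) :
    ∀ᶠ y : ℝ in 𝓝 x, L (y : UnitAddCircle) = L (x : UnitAddCircle) := by
  rw [← nhdsNE_sup_pure, Filter.eventually_sup, ← nhdsLT_sup_nhdsGT, Filter.eventually_sup]
  refine ⟨⟨?_, (hL x).1⟩, rfl⟩
  filter_upwards [(hL x).2] with y h
  rw [h, hx, sub_zero]

lemma eq_on_arc (hL : IsLevel L j) (s δ : ℝ)
    (h : ∀ u ∈ Icc (-1 : ℝ) 1, j (arc s δ u) = 0) {u v : ℝ}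
    (hu : u ∈ Icc (-1 : ℝ) 1) (hv : v ∈ Icc (-1 : ℝ) 1) :
    L (arc s δ u) = L (arc s δ v) := by
  refine isPreconnected_Icc.constant (f := fun u => L (arc s δ u)) ?_ hu hv
  intro w hw
  refine ContinuousAt.continuousWithinAt ?_
  rw [ContinuousAt, nhds_discrete ℤ, Filter.tendsto_pure]
  have hc : ContinuousAt (fun u : ℝ => s + δ * u) w := by fun_prop
  exact hc.eventually (hL.eventually_eq (h w hw))

lemma eq_of_jump_eq_zero (hL : IsLevel L j) (h : ∀ t, j t = 0) (s t : UnitAddCircle) :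
    L s = L t := by
  obtain ⟨x, rfl⟩ := QuotientAddGroup.mk_surjective s
  obtain ⟨y, rfl⟩ := QuotientAddGroup.mk_surjective t
  have := hL.eq_on_arc x (y - x) (fun _ _ => h _) (u := 0) (v := 1) (by simp) (by simp)
  simpa [arc] using this

/-- The points with a nonzero jump are isolated: near `x`, on either side, the values of `L` are
constant. -/
lemma eventually_jump_eq_zero (hL : IsLevel L j) (x : ℝ) :
    (∀ᶠ y : ℝ in 𝓝[>] x, j (y : UnitAddCircle) = 0) ∧
      ∀ᶠ y : ℝ in 𝓝[<] x, j (y : UnitAddCircle) = 0 := by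
  constructor
  · filter_upwards [eventually_eventually_nhdsWithin.2 (hL x).1, (hL x).1,
      self_mem_nhdsWithin] with y h₁ h₂ hy
    rw [IsOpen.nhdsWithin_eq isOpen_Ioi hy] at h₁
    obtain ⟨z, h₃, h₄⟩ := ((h₁.filter_mono nhdsWithin_le_nhds).and (hL y).2).exists
    omega
  · filter_upwards [eventually_eventually_nhdsWithin.2 (hL x).2, (hL x).2,
      self_mem_nhdsWithin] with y h₁ h₂ hy
    rw [IsOpen.nhdsWithin_eq isOpen_Iio hy] at h₁
    obtain ⟨z, h₃, h₄⟩ := ((h₁.filter_mono nhdsWithin_le_nhds).and (hL y).2).exists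
    omega

/-- On the reversed circle the limits from the left become limits from the right, so the
right-continuous level function is the limit from the left of the original one. -/
lemma reverse (hL : IsLevel L j) :
    IsLevel (fun t => L (-t) - j (-t)) (fun t => -j (-t)) := fun x => by
  have h₁ : Filter.Tendsto (fun y : ℝ => -y) (𝓝[>] x) (𝓝[<] (-x)) := tendsto_neg_nhdsGT
  have h₂ : Filter.Tendsto (fun y : ℝ => -y) (𝓝[<] x) (𝓝[>] (-x)) := tendsto_neg_nhdsLT
  constructor
  · filter_upwards [h₁.eventually (hL (-x)).2,
      h₁.eventually (hL.eventually_jump_eq_zero (-x)).2] with y h h'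
    simp only [AddCircle.coe_neg] at h h'
    rw [h, h']; ring
  · filter_upwards [h₂.eventually (hL (-x)).1,
      h₂.eventually (hL.eventually_jump_eq_zero (-x)).1] with y h h'
    simp only [AddCircle.coe_neg] at h h'
    rw [h, h']; ring

lemma comp_orderIso (hL : IsLevel L j) (φ : UnitAddCircle → UnitAddCircle) (g : ℝ ≃o ℝ)
    (hg : ∀ x : ℝ, φ (x : UnitAddCircle) = ((g x : ℝ) : UnitAddCircle)) :
    IsLevel (fun t => L (φ t)) (fun t => j (φ t)) := fun x => by
  have h₁ : Filter.Tendsto g (𝓝[>] x) (𝓝[>] (g x)) :=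
    tendsto_nhdsWithin_iff.2 ⟨g.continuous.continuousAt.mono_left nhdsWithin_le_nhds,
      by filter_upwards [self_mem_nhdsWithin] with y hy using g.strictMono hy⟩
  have h₂ : Filter.Tendsto g (𝓝[<] x) (𝓝[<] (g x)) :=
    tendsto_nhdsWithin_iff.2 ⟨g.continuous.continuousAt.mono_left nhdsWithin_le_nhds,
      by filter_upwards [self_mem_nhdsWithin] with y hy using g.strictMono hy⟩
  simp only [hg]
  exact ⟨h₁.eventually (hL (g x)).1, h₂.eventually (hL (g x)).2⟩

end IsLevel

lemma coe_eq_coe_iff {x y : ℝ} :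
    (x : UnitAddCircle) = (y : UnitAddCircle) ↔ ∃ n : ℤ, x = y + n := by
  rw [← sub_eq_zero, ← AddCircle.coe_sub, AddCircle.coe_eq_zero_iff]
  exact exists_congr fun n => by rw [zsmul_one, eq_sub_iff_add_eq', eq_comm]

/-- A function on the circle that jumps up by one at `a` and down by one at `b`; if
`a ≤ b < a + 1`, it is the indicator function of the positive arc from `a` to `b`. -/
noncomputable def arcIndicator (a b : ℝ) : UnitAddCircle → ℤ :=
  Function.Periodic.lift (f := fun x : ℝ => ⌊x - a⌋ - ⌊x - b⌋) (c := 1) fun x => by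
    beta_reduce
    rw [show x + 1 - a = x - a + 1 by ring, show x + 1 - b = x - b + 1 by ring,
      Int.floor_add_one, Int.floor_add_one]
    ring

lemma arcIndicator_coe (a b x : ℝ) :
    arcIndicator a b (x : UnitAddCircle) = ⌊x - a⌋ - ⌊x - b⌋ := rfl

open Classical in
lemma eventually_floor_sub (a x : ℝ) :
    (∀ᶠ y in 𝓝[>] x, ⌊y - a⌋ = ⌊x - a⌋) ∧
      ∀ᶠ y in 𝓝[<] x, ⌊y - a⌋ = ⌊x - a⌋ -
        if (x : UnitAddCircle) = (a : UnitAddCircle) then 1 else 0 := by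
  have h₁ := Int.floor_le (x - a)
  have h₂ := Int.lt_floor_add_one (x - a)
  constructor
  · filter_upwards [Ioo_mem_nhdsGT (show x < a + ⌊x - a⌋ + 1 by linarith)] with y hy
    rw [Int.floor_eq_iff]
    exact ⟨by linarith [hy.1], by linarith [hy.2]⟩
  · have key : (x : UnitAddCircle) = (a : UnitAddCircle) ↔ x - a = ⌊x - a⌋ := by
      rw [coe_eq_coe_iff]
      constructor
      · rintro ⟨n, rfl⟩
        simp
      · exact fun h => ⟨⌊x - a⌋, by linarith⟩
    split_ifs with hx
    · rw [key] at hx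
      filter_upwards [Ioo_mem_nhdsLT (show x - 1 < x by linarith)] with y hy
      rw [Int.floor_eq_iff]
      push_cast
      exact ⟨by linarith [hy.1], by linarith [hy.2]⟩
    · rw [key] at hx
      have h₃ : (⌊x - a⌋ : ℝ) < x - a := lt_of_le_of_ne h₁ (Ne.symm hx)
      filter_upwards [Ioo_mem_nhdsLT (show a + ⌊x - a⌋ < x by linarith)] with y hy
      rw [Int.floor_eq_iff]
      push_cast
      exact ⟨by linarith [hy.1], by linarith [hy.2]⟩

open Classical in
lemma isLevel_arcIndicator (a b : ℝ) :
    IsLevel (arcIndicator a b) (fun t => (if t = (a : UnitAddCircle) then 1 else 0) -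
      if t = (b : UnitAddCircle) then 1 else 0) := fun x => by
  simp only [arcIndicator_coe]
  constructor
  · filter_upwards [(eventually_floor_sub a x).1, (eventually_floor_sub b x).1] with y h₁ h₂
    rw [h₁, h₂]
  · filter_upwards [(eventually_floor_sub a x).2, (eventually_floor_sub b x).2] with y h₁ h₂
    rw [h₁, h₂]; ring

/-- The indicator function of the middle half of the arc `arc s δ`. -/
noncomputable def midArc (s δ : ℝ) : UnitAddCircle → ℤ :=
  arcIndicator (s + δ * (-1 / 2)) (s + δ * (1 / 2))

open Classical in
lemma isLevel_midArc (s δ : ℝ) :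
    IsLevel (midArc s δ) (fun t => (if t = arc s δ (-1 / 2) then 1 else 0) -
      if t = arc s δ (1 / 2) then 1 else 0) :=
  isLevel_arcIndicator _ _

lemma midArc_center {s δ : ℝ} (h₀ : 0 < δ) (h₁ : 2 * δ < 1) : midArc s δ (arc s δ 0) = 1 := by
  rw [midArc, arc, arcIndicator_coe]
  have e₁ : ⌊s + δ * 0 - (s + δ * (-1 / 2))⌋ = 0 := by
    rw [Int.floor_eq_iff]; constructor <;> push_cast <;> linarith
  have e₂ : ⌊s + δ * 0 - (s + δ * (1 / 2))⌋ = -1 := by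
    rw [Int.floor_eq_iff]; constructor <;> push_cast <;> linarith
  rw [e₁, e₂]; rfl

lemma midArc_of_notMem {s δ : ℝ} (h₀ : 0 < δ) {t : UnitAddCircle}
    (ht : ∀ u ∈ Icc (-1 : ℝ) 1, t ≠ arc s δ u) : midArc s δ t = 0 := by
  obtain ⟨y, hy, rfl⟩ : ∃ y ∈ Ico (s - δ) (s - δ + 1), (y : UnitAddCircle) = t := by
    have := AddCircle.coe_image_Ico_eq (1 : ℝ) (s - δ)
    obtain ⟨y, hy, h⟩ := this.symm ▸ mem_univ t
    exact ⟨y, hy, h⟩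
  have hy' : s + δ < y := by
    by_contra! hle
    refine ht ((y - s) / δ) ⟨?_, ?_⟩ ?_
    · rw [le_div_iff₀ h₀]; linarith [hy.1]
    · rw [div_le_iff₀ h₀]; linarith
    · rw [arc, mul_div_cancel₀ _ h₀.ne', add_sub_cancel]
  rw [midArc, arcIndicator_coe]
  have e₁ : ⌊y - (s + δ * (-1 / 2))⌋ = 0 := by
    rw [Int.floor_eq_iff]; constructor <;> push_cast <;> linarith [hy.2]
  have e₂ : ⌊y - (s + δ * (1 / 2))⌋ = 0 := by
    rw [Int.floor_eq_iff]; constructor <;> push_cast <;> linarith [hy.2]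
  rw [e₁, e₂]; rfl

lemma arc_half_ne {s δ : ℝ} (h₀ : 0 < δ) (h₁ : 2 * δ < 1) :
    arc s δ (-1 / 2) ≠ arc s δ (1 / 2) := by
  intro h
  rw [arc, arc, AddCircle.coe_eq_coe_iff_of_mem_Ico (a := s - δ)] at h
  · linarith
  · constructor <;> linarith
  · constructor <;> linarith

/-! ### The virtual diagram of the lift to the infinite cyclic covering -/

lemma Meet.symm {γ : C(UnitAddCircle, ℝ × ℝ)} {s t : UnitAddCircle} (h : Meet γ s t) :
    Meet γ t s :=
  ⟨h.1.symm, h.2.symm⟩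

lemma DLDiagram.ext_of_line_eq {D D' : DLDiagram} (hc : D.curve = D'.curve)
    (ho : ∀ s t, D.Over s t ↔ D'.Over s t) (hl : ∀ t, D.line t = D'.line t) : D = D' := by
  have ho' : D.Over = D'.Over := by ext s t; exact ho s t
  have hl' : D.line = D'.line := funext hl
  cases D; cases D'
  simp_all

/-- The strand of `s` is over that of `t` in the unwound diagram: the crossing is classical in `D`,
and the strand of `s` has the higher level, or the same level and is over in `D`. -/
def DLDiagram.LiftOver (D : DLDiagram) (L : UnitAddCircle → ℤ) (s t : UnitAddCircle) : Prop :=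
  (D.Over s t ∨ D.Over t s) ∧ (L t < L s ∨ L s = L t ∧ D.Over s t)

lemma DLDiagram.LiftOver.meet {D : DLDiagram} {L : UnitAddCircle → ℤ} {s t : UnitAddCircle}
    (h : D.LiftOver L s t) : Meet D.curve s t :=
  h.1.elim (D.over_meet s t) fun h => (D.over_meet t s h).symm

/-- The virtual diagram of the lift of a knot to `S_g × ℝ`, where `L t` is the level of the lift at
the parameter `t`. -/
def DLDiagram.unwind (D : DLDiagram) (L : UnitAddCircle → ℤ) : VirtualDiagram :=
  ⟨{ curve := D.curve
     finite_meet := D.finite_meet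
     no_triple := D.no_triple
     transverse := D.transverse
     Over := D.LiftOver L
     over_meet := fun _ _ h => h.meet
     over_asymm := fun s t h h' => by
       rcases h.2 with h₁ | ⟨h₁, h₂⟩ <;> rcases h'.2 with h₃ | ⟨h₃, h₄⟩
       · omega
       · omega
       · omega
       · exact D.over_asymm s t h₂ h₄
     line := fun _ => 0
     finite_line := by simp
     line_of_meet := fun _ _ _ => rfl }, fun _ => rfl⟩

/-- A level function of a diagram: it jumps at each double line by its sign. -/
def DLDiagram.HasLevel (D : DLDiagram) (L : UnitAddCircle → ℤ) : Prop :=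
  IsLevel L fun t => (D.line t : ℤ)

lemma unwind_eq_unwind {D D' : DLDiagram} {L L' : UnitAddCircle → ℤ} (hc : D'.curve = D.curve)
    (h : ∀ s t, Meet D.curve s t → (D.LiftOver L s t ↔ D'.LiftOver L' s t)) :
    D.unwind L = D'.unwind L' := by
  refine Subtype.ext (DLDiagram.ext_of_line_eq hc.symm (fun s t => ?_) fun _ => rfl)
  by_cases hm : Meet D.curve s t
  · exact h s t hm
  · exact iff_of_false (fun h' => hm h'.meet) fun h' => hm (hc ▸ h'.meet)

lemma hasLevel_zero (D : VirtualDiagram) : D.1.HasLevel fun _ => 0 := fun x => by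
  simp [D.2]

lemma unwind_virtual (D : VirtualDiagram) {L : UnitAddCircle → ℤ} (hL : D.1.HasLevel L) :
    D.1.unwind L = D := by
  have hc := hL.eq_of_jump_eq_zero (by simp [D.2])
  refine Subtype.ext (DLDiagram.ext_of_line_eq rfl (fun s t => ?_) fun t => (D.2 t).symm)
  change D.1.LiftOver L s t ↔ D.1.Over s t
  simp only [DLDiagram.LiftOver, hc s t, lt_self_iff_false, false_or, true_and]
  tauto

/-! ### Moves of double lines do not change the unwound diagram -/

section DoubleLines

variable {D D' : DLDiagram}

/-- The level function that appears when double lines are changed at the ends of a short arc. -/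
lemma DLDiagram.HasLevel.add_midArc {L : UnitAddCircle → ℤ} (hL : D.HasLevel L) {s δ : ℝ} {c : ℤ}
    (h : arc s δ (-1 / 2) ≠ arc s δ (1 / 2))
    (ha : (D'.line (arc s δ (-1 / 2)) : ℤ) = D.line (arc s δ (-1 / 2)) + c)
    (hb : (D'.line (arc s δ (1 / 2)) : ℤ) = D.line (arc s δ (1 / 2)) - c)
    (ho : ∀ p, p ≠ arc s δ (-1 / 2) → p ≠ arc s δ (1 / 2) → D'.line p = D.line p) :
    D'.HasLevel fun t => L t + c * midArc s δ t := by
  classical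
  have key := hL.add ((isLevel_midArc s δ).const_mul c)
  refine (congrArg (IsLevel _) (funext fun t => ?_)).mpr key
  by_cases h₁ : t = arc s δ (-1 / 2)
  · subst h₁
    rw [ha, if_pos rfl, if_neg h]; ring
  by_cases h₂ : t = arc s δ (1 / 2)
  · subst h₂
    rw [hb, if_neg h₁, if_pos rfl]; ring
  · rw [ho t h₁ h₂, if_neg h₁, if_neg h₂]; ring

/-- The data common to the moves of double lines: the unwound diagrams agree for level functions
that differ by a multiple of the indicator function of an arc, and one of these is a level function
if and only if the other one is. -/
lemma exists_unwind_eq_of_midArc {s δ : ℝ} (c : ℤ) (h : arc s δ (-1 / 2) ≠ arc s δ (1 / 2))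
    (ha : (D'.line (arc s δ (-1 / 2)) : ℤ) = D.line (arc s δ (-1 / 2)) + c)
    (hb : (D'.line (arc s δ (1 / 2)) : ℤ) = D.line (arc s δ (1 / 2)) - c)
    (ho : ∀ p, p ≠ arc s δ (-1 / 2) → p ≠ arc s δ (1 / 2) → D'.line p = D.line p)
    (hu : ∀ L, D.unwind L = D'.unwind fun t => L t + c * midArc s δ t) :
    (∀ L, D.HasLevel L → ∃ L', D'.HasLevel L' ∧ D.unwind L = D'.unwind L') ∧
      ∀ L', D'.HasLevel L' → ∃ L, D.HasLevel L ∧ D.unwind L = D'.unwind L' := by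
  refine ⟨fun L hL => ⟨_, hL.add_midArc h ha hb ho, hu L⟩, fun L' hL' => ⟨_,
    hL'.add_midArc (c := -c) h (by omega) (by omega) (fun p h₁ h₂ => (ho p h₁ h₂).symm), ?_⟩⟩
  rw [hu]
  congr 1
  funext t
  ring

lemma LineSlide.unwind_eq (hD : LineSlide D D') :
    (∀ L, D.HasLevel L → ∃ L', D'.HasLevel L' ∧ D.unwind L = D'.unwind L') ∧
      ∀ L', D'.HasLevel L' → ∃ L, D.HasLevel L ∧ D.unwind L = D'.unwind L' := by
  obtain ⟨s, δ, t, ε, h₀, h₁, -, hc, hm, hn, hl, hl₀, hl', hl₀', hlo, hov, hcase⟩ := hD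
  have hne := arc_half_ne (s := s) h₀ h₁
  refine exists_unwind_eq_of_midArc (s := s) (δ := δ) (-(ε : ℤ)) hne ?_ ?_ ?_ fun L => ?_
  · rw [hl, hl₀' _ (by norm_num) (by norm_num)]; simp
  · rw [hl', hl₀ _ (by norm_num) (by norm_num)]; simp
  · intro p h₂ h₃
    by_cases hp : ∃ u ∈ Icc (-1 : ℝ) 1, p = arc s δ u
    · obtain ⟨u, hu, rfl⟩ := hp
      rw [hl₀ u hu fun h => h₂ (by rw [h]), hl₀' u hu fun h => h₃ (by rw [h])]
    · push Not at hp
      exact hlo p hp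
  · have hout : ∀ p q, Meet D.curve p q → p ≠ arc s δ 0 → midArc s δ p = 0 := by
      intro p q hpq hp
      refine midArc_of_notMem h₀ fun u hu hpu => ?_
      subst hpu
      exact hn u hu (fun h => hp (by rw [h])) q hpq
    have hx := midArc_center (s := s) h₀ h₁
    have ht := hout t _ hm.symm hm.1.symm
    -- the crossing through which the double line slides
    have hcross : (D.LiftOver L (arc s δ 0) t ↔
          D'.LiftOver (fun t => L t + -(ε : ℤ) * midArc s δ t) (arc s δ 0) t) ∧
        (D.LiftOver L t (arc s δ 0) ↔
          D'.LiftOver (fun t => L t + -(ε : ℤ) * midArc s δ t) t (arc s δ 0)) := by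
      simp only [DLDiagram.LiftOver, hx, ht]
      rcases hcase with ⟨rfl, h₂, h₃⟩ | ⟨rfl, h₂, h₃⟩ | ⟨h₂, h₃, h₄, h₅⟩
      · have h₄ := D.over_asymm _ _ h₂
        have h₅ := D'.over_asymm _ _ h₃
        simp only [h₂, h₃, h₄, h₅, SignType.coe_one]
        constructor <;> simp <;> omega
      · have h₄ := D.over_asymm _ _ h₂
        have h₅ := D'.over_asymm _ _ h₃
        simp only [h₂, h₃, h₄, h₅, SignType.coe_neg, SignType.coe_one]
        constructor <;> simp <;> omega
      · simp [h₂, h₃, h₄, h₅]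
    refine unwind_eq_unwind hc fun p q hpq => ?_
    by_cases hp : p = arc s δ 0
    · subst hp
      obtain rfl := D.no_triple _ _ _ hpq hm
      exact hcross.1
    by_cases hq : q = arc s δ 0
    · subst hq
      obtain rfl := D.no_triple _ _ _ hpq.symm hm
      exact hcross.2
    · simp [DLDiagram.LiftOver, hout p q hpq hp, hout q p hpq.symm hq, hov p q hp hq,
        hov q p hq hp]

lemma LinePair.unwind_eq (hD : LinePair D D') :
    (∀ L, D.HasLevel L → ∃ L', D'.HasLevel L' ∧ D.unwind L = D'.unwind L') ∧
      ∀ L', D'.HasLevel L' → ∃ L, D.HasLevel L ∧ D.unwind L = D'.unwind L' := by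
  obtain ⟨s, δ, ε, h₀, h₁, -, hc, hov, hn, hl₀, hl, hl', hlo⟩ := hD
  have hne := arc_half_ne (s := s) h₀ h₁
  refine exists_unwind_eq_of_midArc (s := s) (δ := δ) (ε : ℤ) hne ?_ ?_ hlo fun L => ?_
  · rw [hl, hl₀ _ (by norm_num)]; simp
  · rw [hl', hl₀ _ (by norm_num)]; simp
  · have hout : ∀ p q, Meet D.curve p q → midArc s δ p = 0 := by
      intro p q hpq
      refine midArc_of_notMem h₀ fun u hu hpu => ?_
      subst hpu
      exact hn u hu q hpq
    refine unwind_eq_unwind hc fun p q hpq => ?_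
    simp [DLDiagram.LiftOver, hout p q hpq, hout q p hpq.symm, hov p q, hov q p]

end DoubleLines

/-! ### Reidemeister moves lift to the unwound diagrams -/

section Reidemeister

variable {D D' : DLDiagram} {L : UnitAddCircle → ℤ}

lemma hasLevel_iff_of_line_eq (h : ∀ t, D'.line t = D.line t) : D'.HasLevel L ↔ D.HasLevel L := by
  simp only [DLDiagram.HasLevel, h]

lemma PlanarIsotopy.unwind (h : PlanarIsotopy D D') (L : UnitAddCircle → ℤ) :
    PlanarIsotopy (D.unwind L).1 (D'.unwind L).1 := by
  obtain ⟨H, h₁, h₂, h₃, h₄, -⟩ := h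
  refine ⟨H, h₁, h₂, h₃, fun s t => ?_, fun _ => rfl⟩
  change D'.LiftOver L s t ↔ D.LiftOver L s t
  simp only [DLDiagram.LiftOver, h₄]

lemma Replacement.unwind {n : ℕ} {P P' : Fin n → ℝ → ℝ × ℝ} {s δ : Fin n → ℝ}
    (h : Replacement P P' s δ D D') (L : UnitAddCircle → ℤ) :
    Replacement P P' s δ (D.unwind L).1 (D'.unwind L).1 where
  arcs_disjoint := h.arcs_disjoint
  picture := h.picture
  over_outside p q hp hq := by
    change D'.LiftOver L p q ↔ D.LiftOver L p q
    simp only [DLDiagram.LiftOver, h.over_outside p q hp hq, h.over_outside q p hq hp]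
  line_eq _ := rfl
  line_arc _ _ _ := rfl

lemma Replacement.level_eq {n : ℕ} {P P' : Fin n → ℝ → ℝ × ℝ} {s δ : Fin n → ℝ}
    (h : Replacement P P' s δ D D') (hL : D.HasLevel L) (i : Fin n) {u : ℝ}
    (hu : u ∈ Icc (-1 : ℝ) 1) :
    L (arc (s i) (δ i) u) = L (arc (s i) (δ i) 0) :=
  hL.eq_on_arc _ _ (fun v hv => by simp [h.line_arc i v hv]) hu (by norm_num)

lemma Reidemeister2.unwind (h : Reidemeister2 D D') (hL : D.HasLevel L) :
    Reidemeister2 (D.unwind L).1 (D'.unwind L).1 := by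
  obtain ⟨s, δ, h, ho⟩ := h
  refine ⟨s, δ, h.unwind L, fun i j => ?_⟩
  change D'.LiftOver L _ _ ↔ D'.LiftOver L _ _
  have h₁ := fun i => h.level_eq hL i (u := 1 / 2) (by norm_num)
  have h₂ := fun i => h.level_eq hL i (u := -1 / 2) (by norm_num)
  simp only [DLDiagram.LiftOver, h₁, h₂, ho]

lemma R3param_symm (i j : Fin 3) : R3param j i = R3param i j := by
  fin_cases i <;> fin_cases j <;> rfl

lemma R3param_mem (i j : Fin 3) : R3param i j ∈ Icc (-1 : ℝ) 1 := by
  fin_cases i <;> fin_cases j <;> norm_num [R3param]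

/-- The values of an injective function on `Fin n` can be replaced by their ranks. -/
lemma exists_perm_lt_iff {n : ℕ} {f : Fin n → ℤ} (hf : Function.Injective f) :
    ∃ σ : Equiv.Perm (Fin n), ∀ i j, σ j < σ i ↔ f j < f i := by
  have hm : StrictMono (f ∘ Tuple.sort f) :=
    (Tuple.monotone_sort f).strictMono_of_injective (hf.comp (Tuple.sort f).injective)
  refine ⟨(Tuple.sort f).symm, fun i j => ?_⟩
  rw [← hm.lt_iff_lt]
  simp

/-- The crossing types of the unwound strands of a third move, if strand `i` has level `l i`. -/
lemma R3Allowed.lift {ov : Fin 3 → Fin 3 → Prop} (h : R3Allowed ov) (l : Fin 3 → ℤ) :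
    R3Allowed fun i j => (ov i j ∨ ov j i) ∧ (l j < l i ∨ l i = l j ∧ ov i j) := by
  rcases h with ⟨height, h⟩ | h | ⟨a, b, h⟩
  · -- the lexicographic order by level and height is the order by `3 * level + height`
    have hf : Function.Injective fun i => 3 * l i + ((height i : ℕ) : ℤ) := by
      intro i j hij
      have h₁ := (height i).isLt
      have h₂ := (height j).isLt
      simp only at hij
      exact height.injective (Fin.ext (by omega))
    obtain ⟨σ, hσ⟩ := exists_perm_lt_iff hf
    refine Or.inl ⟨σ, fun i j => ?_⟩
    have h₁ := (height i).isLt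
    have h₂ := (height j).isLt
    have h₃ : (height i : ℕ) = height j → l i = l j := fun e => by
      rw [height.injective (Fin.ext e)]
    beta_reduce
    rw [hσ, h, h, Fin.lt_def, Fin.lt_def]
    omega
  · exact Or.inr (Or.inl fun i j => by simp [h])
  · refine Or.inr (Or.inr ?_)
    by_cases hl : l a < l b
    · refine ⟨b, a, fun i j => ?_⟩
      beta_reduce
      rw [h, h]
      constructor
      · rintro ⟨⟨rfl, rfl⟩ | ⟨rfl, rfl⟩, h₂ | h₂⟩ <;> omega
      · rintro ⟨rfl, rfl⟩
        exact ⟨Or.inr ⟨rfl, rfl⟩, Or.inl hl⟩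
    · refine ⟨a, b, fun i j => ?_⟩
      beta_reduce
      rw [h, h]
      constructor
      · rintro ⟨⟨rfl, rfl⟩ | ⟨rfl, rfl⟩, h₂ | h₂⟩ <;> omega
      · rintro ⟨rfl, rfl⟩
        refine ⟨Or.inl ⟨rfl, rfl⟩, ?_⟩
        rcases (not_lt.1 hl).lt_or_eq with h' | h'
        · exact Or.inl h'
        · exact Or.inr ⟨h'.symm, rfl, rfl⟩

lemma Reidemeister3.unwind (h : Reidemeister3 D D') (hL : D.HasLevel L) :
    Reidemeister3 (D.unwind L).1 (D'.unwind L).1 := by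
  obtain ⟨s, δ, h, ov, hov, ho⟩ := h
  refine ⟨s, δ, h.unwind L, _, hov.lift fun i => L (arc (s i) (δ i) 0), fun i j => ?_⟩
  have hm : ∀ i j, -R3param i j ∈ Icc (-1 : ℝ) 1 := fun i j =>
    ⟨by linarith [(R3param_mem i j).2], by linarith [(R3param_mem i j).1]⟩
  have h₁ := ho i j
  have h₂ := ho j i
  rw [R3param_symm] at h₂
  constructor
  · change D.LiftOver L _ _ ↔ _
    simp only [DLDiagram.LiftOver, h.level_eq hL _ (R3param_mem i j), h₁.1, h₂.1]
  · change D'.LiftOver L _ _ ↔ _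
    simp only [DLDiagram.LiftOver, h.level_eq hL _ (hm i j), h₁.2, h₂.2]

/-- A lift of a homeomorphism of the circle, of degree one, is an increasing bijection. -/
lemma exists_orderIso_lift (φ : UnitAddCircle ≃ₜ UnitAddCircle) (f : CircleDeg1Lift)
    (hf : ∀ x : ℝ, φ (x : UnitAddCircle) = ((f x : ℝ) : UnitAddCircle)) :
    ∃ g : ℝ ≃o ℝ, ∀ x : ℝ, φ (x : UnitAddCircle) = ((g x : ℝ) : UnitAddCircle) := by
  have hinj : Function.Injective f := by
    intro x y hxy
    have h : (x : UnitAddCircle) = (y : UnitAddCircle) := φ.injective (by rw [hf, hf, hxy])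
    obtain ⟨n, rfl⟩ := coe_eq_coe_iff.1 h
    rw [f.map_add_int] at hxy
    linarith
  have hsurj : Function.Surjective f := by
    intro y
    obtain ⟨t, ht⟩ := φ.surjective (y : UnitAddCircle)
    obtain ⟨x, rfl⟩ := QuotientAddGroup.mk_surjective t
    obtain ⟨n, hn⟩ := coe_eq_coe_iff.1 ((hf x).symm.trans ht)
    exact ⟨x - n, by rw [f.map_sub_int, hn, add_sub_cancel_right]⟩
  exact ⟨(f.monotone.strictMono_of_injective hinj).orderIsoOfSurjective f hsurj, hf⟩

lemma Reparametrization.unwind (h : Reparametrization D D') :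
    (∀ L, D.HasLevel L → ∃ L', D'.HasLevel L' ∧
      Reparametrization (D.unwind L).1 (D'.unwind L').1) ∧
    ∀ L', D'.HasLevel L' → ∃ L, D.HasLevel L ∧
      Reparametrization (D.unwind L).1 (D'.unwind L').1 := by
  obtain ⟨φ, ⟨f, hf⟩, hc, ho, hl⟩ := h
  obtain ⟨g, hg⟩ := exists_orderIso_lift φ f hf
  have key : ∀ L, Reparametrization (D.unwind L).1 (D'.unwind fun t => L (φ t)).1 := by
    refine fun L => ⟨φ, ⟨f, hf⟩, hc, fun s t => ?_, fun _ => rfl⟩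
    change D'.LiftOver (fun t => L (φ t)) s t ↔ D.LiftOver L (φ s) (φ t)
    simp only [DLDiagram.LiftOver, ho]
  constructor
  · refine fun L hL => ⟨fun t => L (φ t), ?_, key L⟩
    have := IsLevel.comp_orderIso hL φ g hg
    simpa only [DLDiagram.HasLevel, hl] using this
  · refine fun L' hL' => ⟨fun t => L' (φ.symm t), ?_, ?_⟩
    · have := IsLevel.comp_orderIso hL' φ.symm g.symm fun x => by
        rw [Homeomorph.symm_apply_eq, hg, OrderIso.apply_symm_apply]
      simpa only [DLDiagram.HasLevel, hl, Homeomorph.apply_symm_apply] using this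
    · simpa only [Homeomorph.symm_apply_apply] using key fun t => L' (φ.symm t)

lemma ReidemeisterStep.unwind (h : ReidemeisterStep D D') :
    (∀ L, D.HasLevel L → ∃ L', D'.HasLevel L' ∧
      ReidemeisterStep (D.unwind L).1 (D'.unwind L').1) ∧
    ∀ L', D'.HasLevel L' → ∃ L, D.HasLevel L ∧
      ReidemeisterStep (D.unwind L).1 (D'.unwind L').1 := by
  have of_line_eq (hl : ∀ t, D'.line t = D.line t)
      (hs : ∀ L, D.HasLevel L → ReidemeisterStep (D.unwind L).1 (D'.unwind L).1) :
      (∀ L, D.HasLevel L → ∃ L', D'.HasLevel L' ∧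
        ReidemeisterStep (D.unwind L).1 (D'.unwind L').1) ∧
      ∀ L', D'.HasLevel L' → ∃ L, D.HasLevel L ∧
        ReidemeisterStep (D.unwind L).1 (D'.unwind L').1 :=
    ⟨fun L hL => ⟨L, (hasLevel_iff_of_line_eq hl).2 hL, hs L hL⟩, fun L hL =>
      have hL' := (hasLevel_iff_of_line_eq hl).1 hL
      ⟨L, hL', hs L hL'⟩⟩
  cases h with
  | isotopy h => exact of_line_eq h.choose_spec.2.2.2.2 fun L _ => .isotopy (h.unwind L)
  | reparam h =>
    refine ⟨fun L hL => ?_, fun L hL => ?_⟩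
    · obtain ⟨L', h₁, h₂⟩ := h.unwind.1 L hL
      exact ⟨L', h₁, .reparam h₂⟩
    · obtain ⟨L', h₁, h₂⟩ := h.unwind.2 L hL
      exact ⟨L', h₁, .reparam h₂⟩
  | r1 h =>
    obtain ⟨s, δ, h⟩ := h
    exact of_line_eq h.line_eq fun L _ => .r1 ⟨s, δ, h.unwind L⟩
  | r2 h =>
    exact of_line_eq (by obtain ⟨s, δ, h, -⟩ := h; exact h.line_eq) fun L hL => .r2 (h.unwind hL)
  | r3 h =>
    exact of_line_eq (by obtain ⟨s, δ, h, -⟩ := h; exact h.line_eq) fun L hL => .r3 (h.unwind hL)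

lemma Reversal.symm (h : Reversal D D') : Reversal D' D := by
  obtain ⟨h₁, h₂, h₃⟩ := h
  exact ⟨fun t => by rw [h₁, neg_neg], fun s t => by rw [h₂, neg_neg, neg_neg],
    fun t => by rw [h₃, neg_neg, neg_neg]⟩

lemma Reversal.unwind (h : Reversal D D') (hL : D.HasLevel L) :
    ∃ L', D'.HasLevel L' ∧ Reversal (D.unwind L).1 (D'.unwind L').1 := by
  obtain ⟨h₁, h₂, h₃⟩ := h
  refine ⟨fun t => L (-t) - (D.line (-t) : ℤ), ?_, h₁, fun s t => ?_, fun _ => by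
    change (0 : SignType) = -0; rfl⟩
  · have := IsLevel.reverse hL
    simpa only [DLDiagram.HasLevel, h₃, SignType.coe_neg] using this
  · change D'.LiftOver (fun t => L (-t) - (D.line (-t) : ℤ)) s t ↔ D.LiftOver L (-s) (-t)
    by_cases hm : Meet D.curve (-s) (-t)
    · simp only [DLDiagram.LiftOver, h₂, D.line_of_meet _ _ hm, D.line_of_meet _ _ hm.symm,
        SignType.coe_zero, sub_zero]
    · refine iff_of_false (fun h => hm ?_) fun h => hm h.meet
      exact ⟨fun e => h.meet.1 (neg_injective e), by rw [← h₁, ← h₁, h.meet.2]⟩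

end Reidemeister

/-! ### Equivalence of the unwound diagrams -/

lemma DLStep.unwind {D D' : DLDiagram} (h : DLStep D D') :
    (∀ L, D.HasLevel L → ∃ L', D'.HasLevel L' ∧ VirtualEquiv (D.unwind L) (D'.unwind L')) ∧
      ∀ L', D'.HasLevel L' → ∃ L, D.HasLevel L ∧ VirtualEquiv (D.unwind L) (D'.unwind L') := by
  have of_eq (h : (∀ L, D.HasLevel L → ∃ L', D'.HasLevel L' ∧ D.unwind L = D'.unwind L') ∧
      ∀ L', D'.HasLevel L' → ∃ L, D.HasLevel L ∧ D.unwind L = D'.unwind L') :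
      (∀ L, D.HasLevel L → ∃ L', D'.HasLevel L' ∧ VirtualEquiv (D.unwind L) (D'.unwind L')) ∧
      ∀ L', D'.HasLevel L' → ∃ L, D.HasLevel L ∧
        VirtualEquiv (D.unwind L) (D'.unwind L') :=
    ⟨fun L hL => (h.1 L hL).imp fun L' h' => ⟨h'.1, by rw [h'.2]; exact .refl _⟩,
      fun L hL => (h.2 L hL).imp fun L' h' => ⟨h'.1, by rw [h'.2]; exact .refl _⟩⟩
  cases h with
  | reidemeister h =>
    exact ⟨fun L hL => (h.unwind.1 L hL).imp fun _ h => ⟨h.1, .rel _ _ h.2⟩,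
      fun L hL => (h.unwind.2 L hL).imp fun _ h => ⟨h.1, .rel _ _ h.2⟩⟩
  | slide h => exact of_eq h.unwind_eq
  | pair h => exact of_eq h.unwind_eq

/-- If each step between diagrams with double lines can be followed, in both directions, by an
equivalence of unwound diagrams, then so can each equivalence. Between virtual diagrams, where
unwinding does nothing, it is then an equivalence of virtual diagrams. -/
lemma eqvGen_of_unwind {r : DLDiagram → DLDiagram → Prop}
    {R : VirtualDiagram → VirtualDiagram → Prop}
    (hr : ∀ D D', r D D' →
      (∀ L, D.HasLevel L → ∃ L', D'.HasLevel L' ∧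
        Relation.EqvGen R (D.unwind L) (D'.unwind L')) ∧
      ∀ L', D'.HasLevel L' → ∃ L, D.HasLevel L ∧
        Relation.EqvGen R (D.unwind L) (D'.unwind L'))
    {D₁ D₂ : VirtualDiagram} (h : Relation.EqvGen r D₁.1 D₂.1) : Relation.EqvGen R D₁ D₂ := by
  have key : ∀ D D', Relation.EqvGen r D D' →
      (∀ L, D.HasLevel L → ∃ L', D'.HasLevel L' ∧
        Relation.EqvGen R (D.unwind L) (D'.unwind L')) ∧
      ∀ L', D'.HasLevel L' → ∃ L, D.HasLevel L ∧
        Relation.EqvGen R (D.unwind L) (D'.unwind L') := by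
    intro D D' h
    induction h with
    | rel D D' h => exact hr D D' h
    | refl D => exact ⟨fun L hL => ⟨L, hL, .refl _⟩, fun L hL => ⟨L, hL, .refl _⟩⟩
    | symm D D' _ ih =>
      exact ⟨fun L hL => (ih.2 L hL).imp fun _ h => ⟨h.1, .symm _ _ h.2⟩,
        fun L hL => (ih.1 L hL).imp fun _ h => ⟨h.1, .symm _ _ h.2⟩⟩
    | trans D D' D'' _ _ ih₁ ih₂ =>
      constructor
      · intro L hL
        obtain ⟨L', hL', h₁⟩ := ih₁.1 L hL
        obtain ⟨L'', hL'', h₂⟩ := ih₂.1 L' hL'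
        exact ⟨L'', hL'', .trans _ _ _ h₁ h₂⟩
      · intro L hL
        obtain ⟨L', hL', h₁⟩ := ih₂.2 L hL
        obtain ⟨L'', hL'', h₂⟩ := ih₁.2 L' hL'
        exact ⟨L'', hL'', .trans _ _ _ h₂ h₁⟩
  obtain ⟨L, hL, h'⟩ := (key _ _ h).1 _ (hasLevel_zero D₁)
  rwa [unwind_virtual D₁ (hasLevel_zero D₁), unwind_virtual D₂ hL] at h'

lemma eqvGen_val {r : DLDiagram → DLDiagram → Prop} {R : VirtualDiagram → VirtualDiagram → Prop}
    (hr : ∀ D D', R D D' → r D.1 D'.1) {D₁ D₂ : VirtualDiagram} (h : Relation.EqvGen R D₁ D₂) :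
    Relation.EqvGen r D₁.1 D₂.1 := by
  induction h with
  | rel D D' h => exact .rel _ _ (hr D D' h)
  | refl D => exact .refl _
  | symm D D' _ ih => exact .symm _ _ ih
  | trans D D' D'' _ _ ih₁ ih₂ => exact .trans _ _ _ ih₁ ih₂

lemma VirtualEquiv.unoriented {D D' : VirtualDiagram} (h : VirtualEquiv D D') :
    UnorientedVirtualEquiv D D' :=
  Relation.EqvGen.mono (fun _ _ => Or.inl) _ _ h

end SgS1

theorem mainTheorem1 :
    (∀ D₁ D₂ : SgS1.VirtualDiagram,
      SgS1.DLEquiv D₁.1 D₂.1 ↔ SgS1.VirtualEquiv D₁ D₂) ∧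
    (∀ D₁ D₂ : SgS1.VirtualDiagram,
      SgS1.UnorientedDLEquiv D₁.1 D₂.1 ↔ SgS1.UnorientedVirtualEquiv D₁ D₂) := by
  refine ⟨fun D₁ D₂ => ⟨SgS1.eqvGen_of_unwind fun D D' h => h.unwind,
      SgS1.eqvGen_val fun D D' h => .reidemeister h⟩,
    fun D₁ D₂ => ⟨SgS1.eqvGen_of_unwind fun D D' h => ?_,
      SgS1.eqvGen_val fun D D' h => h.imp_left .reidemeister⟩⟩
  rcases h with h | h
  · exact ⟨fun L hL => (h.unwind.1 L hL).imp fun _ h => ⟨h.1, h.2.unoriented⟩,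
      fun L hL => (h.unwind.2 L hL).imp fun _ h => ⟨h.1, h.2.unoriented⟩⟩
  · exact ⟨fun L hL => (h.unwind hL).imp fun _ h => ⟨h.1, .rel _ _ (Or.inr h.2)⟩,
      fun L hL => (h.symm.unwind hL).imp fun _ h => ⟨h.1, .rel _ _ (Or.inr h.2.symm)⟩⟩
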